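/- Let $H_1,H_2$ be real Hilbert spaces (possibly infinite dimensional), $L:H_1\to H_2$ a bounded linear operator with adjoint $L^*$, $g:H_1\to\mathbb R\cup\{\infty\}$ and $f:H_2\to\mathbb R\cup\{\infty\}$ proper, convex and lower semicontinuous, and $\lambda>0$. Consider the primal and dual problems $$(P)\quad \min_{u\in H_1}\{g(u)+f(Lu)\},\qquad (D)\quad -\min_{b\in H_2}\{g^*(-L^*b)+f^*(b)\},$$ where $g^*,f^*$ are the Fenchel conjugates; a solution of either problem is a minimizer with finite objective value. Given $b^0,d^0\in H_2$, the alternating split Bregman algorithm performs, for $k\ge 1$: choose a minimizer $u^k$ over $H_1$ of $I_1^k(u)=g(u)+\frac\lambda2\|b^{k-1}+Lu-d^{k-1}\|^2$; choose a minimizer $d^k$ over $H_2$ of $I_2^k(d)=f(d)+\frac\lambda2\|b^{k-1}+Lu^k-d\|^2$; put $b^k=b^{k-1}+Lu^k-d^k$. The algorithm is called well defined if for all $k\ge1$ the functionals $I_1^k$ and $I_2^k$ have minimizers. Assume that at least one of the following regularity conditions holds: (i) there is $x\in\operatorname{dom}(g)\cap\operatorname{dom}(f\circ L)$ such that $f$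 is continuous at $Lx$; (ii) $0\in\operatorname{int}(L\operatorname{dom}(g)-\operatorname{dom}(f))$. **Theorem.** Assume that both $(P)$ and $(D)$ have solutions and that $L^*L:H_1\to H_1$ is surjective. Then for all $b^0,d^0\in H_2$ the alternating split Bregman algorithm is well defined, and the sequences $\{b^k\}$ and $\{d^k\}$ converge weakly to some $\hat b$ and $\hat d$, respectively. Moreover, $\lambda\hat b$ is a solution of $(D)$, $\{d^k-Lu^{k+1}\}$ converges strongly to zero, and $$\sum_{k=0}^\infty\|d^k-Lu^{k+1}\|^2<\infty.$$ Furthermore, there exists a unique $\hat u\in H_1$ such that $L\hat u=\hat d$, and $\hat u$ is a solution of $(P)$. In particular, $\{u^k\}$ has at most one weak cluster point, and any weak cluster point equals $\hat u$. -/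

import Mathlib

open Set Filter Topology

noncomputable section

namespace SplitBregman

variable {H H₁ H₂ : Type*}
  [NormedAddCommGroup H] [InnerProductSpace ℝ H]
  [NormedAddCommGroup H₁] [InnerProductSpace ℝ H₁] [CompleteSpace H₁]
  [NormedAddCommGroup H₂] [InnerProductSpace ℝ H₂] [CompleteSpace H₂]

/-- The effective domain of an extended-real-valued function. -/
def effDom (φ : H → EReal) : Set H := {x | φ x ≠ ⊤}

/-- A proper convex lower semicontinuous function with values in `ℝ ∪ {∞}`.
The convexity inequality uses `0 * ⊤ = 0` in `EReal`, so it is trivially true for weights `0, 1`. -/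
structure IsProperConvexLsc (φ : H → EReal) : Prop where
  ne_bot : ∀ x, φ x ≠ ⊥
  proper : (effDom φ).Nonempty
  convex : ∀ x y : H, ∀ s t : ℝ, 0 ≤ s → 0 ≤ t → s + t = 1 →
    φ (s • x + t • y) ≤ (s : EReal) * φ x + (t : EReal) * φ y
  lsc : LowerSemicontinuous φ

/-- The Fenchel conjugate `φ*(p) = sup_x (⟨p, x⟩ - φ x)`. -/
def conjugate (φ : H → EReal) (p : H) : EReal :=
  ⨆ x : H, ((inner ℝ p x : ℝ) : EReal) - φ x

/-- The functional `u ↦ g u + f (L u)` minimized in the primal problem. -/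
def primalObjective (g : H₁ → EReal) (f : H₂ → EReal) (L : H₁ →L[ℝ] H₂) (u : H₁) : EReal :=
  g u + f (L u)

/-- The functional `b ↦ g*(-L* b) + f*(b)` minimized in the dual problem. -/
def dualObjective (g : H₁ → EReal) (f : H₂ → EReal) (L : H₁ →L[ℝ] H₂) (b : H₂) : EReal :=
  conjugate g (-(ContinuousLinearMap.adjoint L b)) + conjugate f b

/-- `x` is an optimal solution of the problem of minimizing `φ`: it is feasible
(`φ x` is not `∞`) and a global minimizer. -/
def IsSolution (φ : H → EReal) (x : H) : Prop := φ x ≠ ⊤ ∧ IsMinOn φ univ x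

/-- The regularity condition of Fenchel duality: `f` is continuous at `L x` for some
`x ∈ dom g ∩ dom (f ∘ L)`, or `0` is an interior point of `L (dom g) - dom f`. -/
def RegularityCondition (g : H₁ → EReal) (f : H₂ → EReal) (L : H₁ →L[ℝ] H₂) : Prop :=
  (∃ x : H₁, x ∈ effDom g ∧ L x ∈ effDom f ∧ ContinuousAt f (L x)) ∨
    (0 : H₂) ∈ interior {w : H₂ | ∃ x ∈ effDom g, ∃ y ∈ effDom f, w = L x - y}

/-- The functional of the first substep, `u ↦ g u + (lam / 2) ‖b + L u - d‖²`. -/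
def uObjective (g : H₁ → EReal) (L : H₁ →L[ℝ] H₂) (lam : ℝ) (b d : H₂) (u : H₁) : EReal :=
  g u + ((lam / 2 * ‖b + L u - d‖ ^ 2 : ℝ) : EReal)

/-- The functional of the second substep, `d ↦ f d + (lam / 2) ‖b + L u - d‖²`. -/
def dObjective (f : H₂ → EReal) (L : H₁ →L[ℝ] H₂) (lam : ℝ) (b : H₂) (u : H₁) (d : H₂) : EReal :=
  f d + ((lam / 2 * ‖b + L u - d‖ ^ 2 : ℝ) : EReal)

/-- `u`, `b`, `d` satisfy the rule by which step `k + 1` of the alternating split Bregman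
algorithm computes `u (k + 1)`, `d (k + 1)`, `b (k + 1)` from `b k`, `d k`. -/
structure IsStep (g : H₁ → EReal) (f : H₂ → EReal) (L : H₁ →L[ℝ] H₂) (lam : ℝ)
    (u : ℕ → H₁) (b d : ℕ → H₂) (k : ℕ) : Prop where
  u_min : IsMinOn (uObjective g L lam (b k) (d k)) univ (u (k + 1))
  d_min : IsMinOn (dObjective f L lam (b k) (u (k + 1))) univ (d (k + 1))
  b_eq : b (k + 1) = b k + L (u (k + 1)) - d (k + 1)

/-- `u`, `b`, `d` are produced by the algorithm started at `b₀`, `d₀`.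
The value `u 0` plays no role. -/
def IsRun (g : H₁ → EReal) (f : H₂ → EReal) (L : H₁ →L[ℝ] H₂) (lam : ℝ) (b₀ d₀ : H₂)
    (u : ℕ → H₁) (b d : ℕ → H₂) : Prop :=
  b 0 = b₀ ∧ d 0 = d₀ ∧ ∀ k, IsStep g f L lam u b d k

/-- The algorithm started at `b₀`, `d₀` is well defined: however its first `n` steps have been
carried out, both functionals to be minimized in the next step have minimizers. -/
def WellDefined (g : H₁ → EReal) (f : H₂ → EReal) (L : H₁ →L[ℝ] H₂) (lam : ℝ)
    (b₀ d₀ : H₂) : Prop :=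
  ∀ (n : ℕ) (u : ℕ → H₁) (b d : ℕ → H₂), b 0 = b₀ → d 0 = d₀ →
    (∀ k < n, IsStep g f L lam u b d k) →
    (∃ v : H₁, IsMinOn (uObjective g L lam (b n) (d n)) univ v) ∧
    ∀ v : H₁, IsMinOn (uObjective g L lam (b n) (d n)) univ v →
      ∃ w : H₂, IsMinOn (dObjective f L lam (b n) v) univ w

/-- Weak convergence of a sequence. -/
def WeaklyTendsto (x : ℕ → H) (a : H) : Prop :=
  Tendsto (fun k => toWeakSpace ℝ H (x k)) atTop (𝓝 (toWeakSpace ℝ H a))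

/-- `a` is a cluster point of the sequence `x` in the weak topology (in particular every weak
limit of a subsequence is one). -/
def IsWeakClusterPt (x : ℕ → H) (a : H) : Prop :=
  MapClusterPt (toWeakSpace ℝ H a) atTop (fun k => toWeakSpace ℝ H (x k))

end SplitBregman

end

/-! The algorithm is a Douglas–Rachford iteration in the variable `b + d`. Optimality of the
substeps says that `λ bᵏ` is a subgradient of `f` at `dᵏ`, that `-L*(λ(bᵏ + L uᵏ⁺¹ - dᵏ))` is one of
`g` at `uᵏ⁺¹`, and that `bᵏ⁺¹ + dᵏ⁺¹ = bᵏ + L uᵏ⁺¹`.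

The regularity condition gives a primal solution a multiplier (`exists_isKKT`: Baire, then
separation). For a Kuhn–Tucker pair `(u, λ b)`, monotonicity of subgradients makes the squared
distance of `bᵏ + dᵏ` to `b + L u` drop by at least `‖dᵏ - L uᵏ⁺¹‖²` (`fejer`). Hence the series
converges and the sequences are bounded.

Weak limits along ultrafilters are Kuhn–Tucker pairs (`isKKT_of_weakLim`), and Opial's argument
makes them coincide (`eq_of_weakLim`), so the whole sequences converge weakly. Surjectivity of `L*
L` gives a bounded left inverse of `L`. It makes the `u`-subproblem coercive and transfers weak
convergence from `d` to `u`. -/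

namespace SplitBregman

/-! ### Weak limits and existence of minimizers -/

section WeakConvergence

variable {ι H K : Type*} [NormedAddCommGroup H] [InnerProductSpace ℝ H]
  [NormedAddCommGroup K] [InnerProductSpace ℝ K]

/-- Weak convergence along a filter, tested against inner products. -/
def WeakLim (F : Filter ι) (x : ι → H) (a : H) : Prop :=
  ∀ y, Tendsto (fun i => inner ℝ (x i) y) F (𝓝 (inner ℝ a y))

namespace WeakLim

variable {F G : Filter ι} {x z : ι → H} {a c : H}

theorem mono (h : WeakLim F x a) (hG : G ≤ F) : WeakLim G x a :=
  fun y => (h y).mono_left hG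

theorem of_shift {x : ℕ → H} (n : ℕ) (h : WeakLim atTop (fun k => x (k + n)) a) :
    WeakLim atTop x a := fun y => (tendsto_add_atTop_iff_nat n).1 (h y)

theorem of_tendsto (h : Tendsto x F (𝓝 a)) : WeakLim F x a :=
  fun _ => h.inner tendsto_const_nhds

theorem add (hx : WeakLim F x a) (hz : WeakLim F z c) :
    WeakLim F (fun i => x i + z i) (a + c) := fun y => by
  simpa only [inner_add_left] using (hx y).add (hz y)

theorem sub (hx : WeakLim F x a) (hz : WeakLim F z c) :
    WeakLim F (fun i => x i - z i) (a - c) := fun y => by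
  simpa only [inner_sub_left] using (hx y).sub (hz y)

theorem map [CompleteSpace H] [CompleteSpace K] (A : H →L[ℝ] K) (hx : WeakLim F x a) :
    WeakLim F (fun i => A (x i)) (A a) := fun y => by
  simpa only [ContinuousLinearMap.adjoint_inner_right] using
    hx (ContinuousLinearMap.adjoint A y)

variable [CompleteSpace H]

/-- Closed convex sets are weakly closed. -/
theorem mem_of_eventually [NeBot F] {C : Set H} (hC : Convex ℝ C) (hcl : IsClosed C)
    (hx : WeakLim F x a) (h : ∀ᶠ i in F, x i ∈ C) : a ∈ C := by
  by_contra ha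
  obtain ⟨l, s, hs, hl⟩ := geometric_hahn_banach_point_closed hC hcl ha
  have key : ∀ z, l z = inner ℝ z ((InnerProductSpace.toDual ℝ H).symm l) := fun z => by
    rw [real_inner_comm, InnerProductSpace.toDual_symm_apply]
  have := ge_of_tendsto (hx ((InnerProductSpace.toDual ℝ H).symm l))
    (h.mono fun i hi => (key (x i) ▸ (hl _ hi).le : s ≤ _))
  rw [← key] at this
  linarith

/-- Bounded sets of a Hilbert space are relatively weakly compact. -/
theorem exists_of_bounded (U : Ultrafilter ι) {R : ℝ} (h : ∀ᶠ i in U, ‖x i‖ ≤ R) :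
    ∃ a, WeakLim U x a := by
  have hex : ∀ y, ∃ l, Tendsto (fun i => inner ℝ (x i) y) U (𝓝 l) ∧ |l| ≤ R * ‖y‖ := by
    intro y
    have hm : Icc (-(R * ‖y‖)) (R * ‖y‖) ∈ U.map (fun i => inner ℝ (x i) y) := by
      refine h.mono fun i hi => abs_le.1 ?_
      exact (abs_real_inner_le_norm _ _).trans (by gcongr)
    obtain ⟨l, hl, hle⟩ := isCompact_Icc.ultrafilter_le_nhds' _ hm
    exact ⟨l, hle, abs_le.2 hl⟩
  choose l hl hb using hex
  -- The limits of the inner products form a bounded functional; its Riesz representative is the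
  -- weak limit.
  let T : H →ₗ[ℝ] ℝ :=
    { toFun := l
      map_add' := fun y z => tendsto_nhds_unique (hl (y + z)) (by
        simpa only [inner_add_right] using (hl y).add (hl z))
      map_smul' := fun s y => tendsto_nhds_unique (hl (s • y)) (by
        simpa only [inner_smul_right, RingHom.id_apply, smul_eq_mul] using (hl y).const_mul s) }
  refine ⟨(InnerProductSpace.toDual ℝ H).symm (T.mkContinuous R hb), fun y => ?_⟩
  rw [InnerProductSpace.toDual_symm_apply]
  exact hl y

theorem norm_le [NeBot F] {R : ℝ} (hx : WeakLim F x a) (h : ∀ᶠ i in F, ‖x i‖ ≤ R) : ‖a‖ ≤ R := by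
  simpa using hx.mem_of_eventually (convex_closedBall (0 : H) R) Metric.isClosed_closedBall
    (h.mono fun i hi => by simpa using hi)

/-- Weak lower semicontinuity of lower semicontinuous quasiconvex functions. -/
theorem eventually_lt {φ : H → EReal} (hlsc : LowerSemicontinuous φ)
    (hconv : ∀ r : ℝ, Convex ℝ {x | φ x ≤ r}) (hx : WeakLim F x a) {r : ℝ} (hr : r < φ a) :
    ∀ᶠ i in F, r < φ (x i) := by
  by_contra hcon
  have hfr : ∃ᶠ i in F, i ∈ {i | φ (x i) ≤ r} :=
    (not_eventually.1 hcon).mono fun i hi => not_lt.1 hi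
  have := frequently_mem_iff_neBot.1 hfr
  have hmem := (hx.mono inf_le_left).mem_of_eventually (hconv r) (hlsc.isClosed_preimage r)
    (F := F ⊓ 𝓟 {i | φ (x i) ≤ r}) (eventually_inf_principal.2 (Eventually.of_forall fun i hi => hi))
  exact absurd hr (not_lt.2 hmem)

end WeakLim

variable [CompleteSpace H]

theorem weaklyTendsto_of_weakLim {x : ℕ → H} {a : H} (h : WeakLim atTop x a) :
    WeaklyTendsto x a := by
  have hinj : Function.Injective (topDualPairing ℝ H).flip := by
    intro p q hpq
    refine ext_inner_left ℝ fun y => ?_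
    exact LinearMap.congr_fun hpq (InnerProductSpace.toDual ℝ H y)
  refine (WeakBilin.tendsto_iff_forall_eval_tendsto _ hinj).2 fun l => ?_
  have key : ∀ z, l z = inner ℝ z ((InnerProductSpace.toDual ℝ H).symm l) := fun z => by
    rw [real_inner_comm, InnerProductSpace.toDual_symm_apply]
  change Tendsto (fun k => l (x k)) atTop (𝓝 (l a))
  simpa only [key] using h _

theorem IsWeakClusterPt.eq_of_weakLim {x : ℕ → H} {a c : H} (hc : IsWeakClusterPt x c)
    (h : WeakLim atTop x a) : c = a := by
  refine ext_inner_left ℝ fun y => ?_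
  have hcont : Continuous fun z : WeakSpace ℝ H => inner ℝ y ((toWeakSpace ℝ H).symm z) :=
    WeakBilin.eval_continuous (topDualPairing ℝ H).flip (InnerProductSpace.toDual ℝ H y)
  have h1 : MapClusterPt (inner ℝ y c) atTop fun k => inner ℝ y (x k) :=
    MapClusterPt.tendsto_comp (X := WeakSpace ℝ H) (hcont.tendsto (toWeakSpace ℝ H c)) hc
  have h2 : Tendsto (fun k => inner ℝ y (x k)) atTop (𝓝 (inner ℝ y a)) := by
    simpa only [real_inner_comm] using h y
  by_contra hne
  have h3 : ClusterPt (inner ℝ y c) (𝓝 (inner ℝ y a)) := ClusterPt.mono h1 h2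
  exact hne (eq_of_nhds_neBot h3)

/-- A lower semicontinuous quasiconvex function with a nonempty bounded sublevel set attains
its minimum. -/
theorem exists_isMinOn_of_bounded_sublevel {φ : H → EReal} (hlsc : LowerSemicontinuous φ)
    (hconv : ∀ r : ℝ, Convex ℝ {x | φ x ≤ r}) {c R : ℝ} {x₀ : H} (hx₀ : φ x₀ ≤ c)
    (hR : ∀ x, φ x ≤ c → ‖x‖ ≤ R) : ∃ x, IsMinOn φ univ x := by
  -- If the infimum is below `c`, a minimizing sequence is eventually bounded; otherwise `x₀` is
  -- already a minimizer.
  by_cases hm : ⨅ x, φ x < c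
  · obtain ⟨v, -, hv, hmem⟩ :=
      exists_seq_tendsto_sInf (range_nonempty φ) (OrderBot.bddBelow (range φ))
    choose x hx using hmem
    have hU : (hyperfilter ℕ : Filter ℕ) ≤ atTop := Nat.hyperfilter_le_atTop
    obtain ⟨a, ha⟩ := WeakLim.exists_of_bounded (x := x) (hyperfilter ℕ) (R := R) <|
      ((hv.eventually_lt_const hm).filter_mono hU).mono fun n hn => hR _ ((hx n).trans_le hn.le)
    refine ⟨a, fun z _ => ?_⟩
    refine le_trans (not_lt.1 fun hlt => ?_) (iInf_le φ z)
    obtain ⟨r, hr, hr'⟩ := EReal.lt_iff_exists_real_btwn.1 hlt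
    have h1 := ha.eventually_lt hlsc hconv hr'
    have h2 := (hv.eventually_lt_const hr).filter_mono hU
    obtain ⟨n, hn1, hn2⟩ := (h1.and h2).exists
    exact lt_asymm hn1 ((hx n).symm ▸ hn2)
  · exact ⟨x₀, fun z _ => hx₀.trans ((not_lt.1 hm).trans (iInf_le φ z))⟩

end WeakConvergence

/-! ### Subgradients and least-squares perturbations -/

section ConvexFunctions

variable {H K : Type*} [NormedAddCommGroup H] [InnerProductSpace ℝ H]
  [NormedAddCommGroup K] [InnerProductSpace ℝ K] {φ : H → EReal}

namespace IsProperConvexLsc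

theorem coe_toReal (hφ : IsProperConvexLsc φ) {x : H} (hx : φ x ≠ ⊤) :
    ((φ x).toReal : EReal) = φ x := EReal.coe_toReal hx (hφ.ne_bot x)

theorem combo_le (hφ : IsProperConvexLsc φ) {x y : H} {r q s t : ℝ} (hx : φ x ≤ r) (hy : φ y ≤ q)
    (hs : 0 ≤ s) (ht : 0 ≤ t) (hst : s + t = 1) : φ (s • x + t • y) ≤ (s * r + t * q : ℝ) := by
  refine (hφ.convex x y s t hs ht hst).trans ?_
  rw [EReal.coe_add, EReal.coe_mul, EReal.coe_mul]
  exact add_le_add (mul_le_mul_of_nonneg_left hx (EReal.coe_nonneg.2 hs))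
    (mul_le_mul_of_nonneg_left hy (EReal.coe_nonneg.2 ht))

theorem convex_sublevel (hφ : IsProperConvexLsc φ) (r : ℝ) : Convex ℝ {x | φ x ≤ r} := by
  intro x hx y hy s t hs ht hst
  have := hφ.combo_le hx hy hs ht hst
  rwa [← add_mul, hst, one_mul] at this

theorem toReal_le (hφ : IsProperConvexLsc φ) {x : H} {r : ℝ} (h : φ x ≤ r) :
    (φ x).toReal ≤ r := by
  rw [← EReal.coe_le_coe_iff, hφ.coe_toReal (ne_top_of_le_ne_top (EReal.coe_ne_top r) h)]
  exact h

end IsProperConvexLsc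

/-- `p` is a subgradient of `φ` at `x`. -/
def IsSubgradient (φ : H → EReal) (x p : H) : Prop :=
  φ x ≠ ⊤ ∧ ∀ y, φ y ≠ ⊤ → (φ x).toReal + inner ℝ p (y - x) ≤ (φ y).toReal

theorem IsSubgradient.monotone {x y p q : H} (hp : IsSubgradient φ x p)
    (hq : IsSubgradient φ y q) : 0 ≤ inner ℝ (p - q) (x - y) := by
  have h1 := hp.2 y hq.1
  have h2 := hq.2 x hp.1
  simp only [inner_sub_left, inner_sub_right] at *
  linarith

theorem add_coe_le_iff {a : EReal} {r q : ℝ} : a + (q : EReal) ≤ r ↔ a ≤ (r - q : ℝ) := by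
  rw [EReal.coe_sub, EReal.le_sub_iff_add_le (Or.inl (EReal.coe_ne_bot q))
    (Or.inl (EReal.coe_ne_top q))]

theorem norm_add_smul_sq (x h : K) (t : ℝ) :
    ‖x + t • h‖ ^ 2 = ‖x‖ ^ 2 + 2 * t * inner ℝ x h + t ^ 2 * ‖h‖ ^ 2 := by
  rw [norm_add_sq_real, inner_smul_right, norm_smul, mul_pow, Real.norm_eq_abs, sq_abs]
  ring

variable {A : H →L[ℝ] K} {c : K} {lam : ℝ}

/-- First-order optimality condition for a least-squares perturbation of a convex function. -/
theorem IsProperConvexLsc.isSubgradient_of_isMinOn [CompleteSpace H] [CompleteSpace K]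
    (hφ : IsProperConvexLsc φ) {x : H}
    (hx : IsMinOn (fun x => φ x + ((lam / 2 * ‖c + A x‖ ^ 2 : ℝ) : EReal)) univ x) :
    IsSubgradient φ x (-(ContinuousLinearMap.adjoint A (lam • (c + A x)))) := by
  have hx' : ∀ y, φ x + ((lam / 2 * ‖c + A x‖ ^ 2 : ℝ) : EReal)
      ≤ φ y + ((lam / 2 * ‖c + A y‖ ^ 2 : ℝ) : EReal) := fun y => hx (mem_univ y)
  have hval : ∀ y (r : ℝ), φ y ≤ r →
      φ x ≤ (r + lam / 2 * ‖c + A y‖ ^ 2 - lam / 2 * ‖c + A x‖ ^ 2 : ℝ) := by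
    intro y r hr
    rw [← add_coe_le_iff, EReal.coe_add]
    exact (hx' y).trans (by gcongr)
  have htop : φ x ≠ ⊤ := by
    obtain ⟨y, hy⟩ := hφ.proper
    exact ne_top_of_le_ne_top (EReal.coe_ne_top _) (hval y _ (hφ.coe_toReal hy).ge)
  refine ⟨htop, fun y hy => ?_⟩
  have hin : inner ℝ (-(ContinuousLinearMap.adjoint A (lam • (c + A x)))) (y - x)
      = -(lam * inner ℝ (c + A x) (A (y - x))) := by
    rw [inner_neg_left, ContinuousLinearMap.adjoint_inner_left, inner_smul_left]; rfl
  rw [hin]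
  -- Compare `x` with a point of the segment towards `y`, divide by `t`, and let `t → 0`.
  have hineq : ∀ t ∈ Ioo (0 : ℝ) 1, (φ x).toReal - (φ y).toReal
      - lam * inner ℝ (c + A x) (A (y - x)) ≤ t * (lam / 2 * ‖A (y - x)‖ ^ 2) := by
    intro t ht
    have h1 := hφ.toReal_le (hval _ _ (hφ.combo_le (hφ.coe_toReal htop).ge (hφ.coe_toReal hy).ge
      (sub_nonneg.2 ht.2.le) ht.1.le (sub_add_cancel 1 t)))
    have h2 : c + A ((1 - t) • x + t • y) = (c + A x) + t • A (y - x) := by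
      simp only [map_add, map_smul, map_sub, sub_smul, smul_sub, one_smul]; abel
    rw [h2, norm_add_smul_sq] at h1
    refine le_of_mul_le_mul_left ?_ ht.1
    nlinarith [h1]
  have hlim : Tendsto (fun t : ℝ => t * (lam / 2 * ‖A (y - x)‖ ^ 2)) (𝓝[>] 0) (𝓝 0) := by
    have : Continuous fun t : ℝ => t * (lam / 2 * ‖A (y - x)‖ ^ 2) := by fun_prop
    simpa using (this.tendsto 0).mono_left nhdsWithin_le_nhds
  have := ge_of_tendsto hlim (eventually_of_mem (Ioo_mem_nhdsGT one_pos) hineq)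
  linarith

/-- A least-squares perturbation with injective closed-range operator of a subdifferentiable
convex function attains its minimum. -/
theorem IsProperConvexLsc.exists_isMinOn_add_sq [CompleteSpace H]
    (hφ : IsProperConvexLsc φ) (hlam : 0 < lam) {M : ℝ} (hA : ∀ x, ‖x‖ ≤ M * ‖A x‖)
    {x₀ p : H} (hp : IsSubgradient φ x₀ p) :
    ∃ x, IsMinOn (fun x => φ x + ((lam / 2 * ‖c + A x‖ ^ 2 : ℝ) : EReal)) univ x := by
  have hM : ∀ x, ‖x‖ ≤ |M| * (‖c + A x‖ + ‖c‖) := fun x => by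
    have h1 : ‖A x‖ ≤ ‖c + A x‖ + ‖c‖ := by
      simpa using norm_sub_le (c + A x) c
    exact (hA x).trans (mul_le_mul (le_abs_self M) h1 (norm_nonneg _) (abs_nonneg _))
  set v := lam / 2 * ‖c + A x₀‖ ^ 2 with hv
  -- With `s = ‖c + A x‖`, the subgradient bounds `lam / 2 * s ^ 2` on the sublevel set by an affine
  -- function of `s` whose coefficients sum to `B`. So `s ≤ 1` or `s ≤ 2 * B / lam`.
  set B := |v| + ‖p‖ * (|M| * ‖c‖ + ‖x₀‖) + ‖p‖ * |M| with hB
  have hB0 : 0 ≤ B := by positivity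
  refine exists_isMinOn_of_bounded_sublevel (c := (φ x₀).toReal + v)
    (R := |M| * ((1 + 2 * B / lam) + ‖c‖)) (x₀ := x₀) ?_ ?_ ?_ ?_
  · refine hφ.lsc.add' (Continuous.lowerSemicontinuous ?_) fun x =>
      EReal.continuousAt_add (Or.inr (EReal.coe_ne_bot _)) (Or.inl (hφ.ne_bot x))
    exact continuous_coe_real_ereal.comp (by fun_prop)
  · intro r x hx y hy s t hs ht hst
    simp only [mem_ofPred_eq, add_coe_le_iff] at hx hy ⊢
    refine (hφ.combo_le hx hy hs ht hst).trans (EReal.coe_le_coe_iff.2 ?_)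
    have h1 : c + A (s • x + t • y) = s • (c + A x) + t • (c + A y) := by
      have : c = s • c + t • c := by rw [← add_smul, hst, one_smul]
      simp only [map_add, map_smul, smul_add]
      nth_rewrite 1 [this]
      abel
    have h2 : ‖c + A (s • x + t • y)‖ ^ 2 ≤ s * ‖c + A x‖ ^ 2 + t * ‖c + A y‖ ^ 2 := by
      rw [h1]
      exact ((convexOn_norm convex_univ).pow (fun _ _ => norm_nonneg _) 2).2
        (mem_univ (c + A x)) (mem_univ (c + A y)) hs ht hst
    have h3 : s * r + t * r = r := by rw [← add_mul, hst, one_mul]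
    nlinarith [mul_le_mul_of_nonneg_left h2 (half_pos hlam).le]
  · rw [EReal.coe_add, hφ.coe_toReal hp.1]
  · intro x hx
    rw [add_coe_le_iff] at hx
    have h1 := hp.2 x (ne_top_of_le_ne_top (EReal.coe_ne_top _) hx)
    have h2 := hφ.toReal_le hx
    have h3 : -(‖p‖ * (‖x‖ + ‖x₀‖)) ≤ inner ℝ p (x - x₀) := by
      have := (abs_le.1 (abs_real_inner_le_norm p (x - x₀))).1
      have h4 : ‖p‖ * ‖x - x₀‖ ≤ ‖p‖ * (‖x‖ + ‖x₀‖) := by gcongr; exact norm_sub_le _ _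
      linarith
    have h5 : ‖p‖ * ‖x‖ ≤ ‖p‖ * (|M| * (‖c + A x‖ + ‖c‖)) := by gcongr; exact hM x
    refine (hM x).trans ?_
    gcongr
    set s := ‖c + A x‖
    have hs0 : 0 ≤ s := norm_nonneg _
    have h6 : lam / 2 * s ^ 2 ≤ |v| + ‖p‖ * (|M| * ‖c‖ + ‖x₀‖) + ‖p‖ * |M| * s := by
      nlinarith [le_abs_self v]
    by_cases hs1 : s ≤ 1
    · have : 0 ≤ 2 * B / lam := by positivity
      linarith
    · push Not at hs1
      have h7 : lam / 2 * s ^ 2 ≤ B * s := by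
        have : 0 ≤ |v| + ‖p‖ * (|M| * ‖c‖ + ‖x₀‖) := by positivity
        nlinarith
      have h8 : lam / 2 * s ≤ B := le_of_mul_le_mul_right (by nlinarith) (one_pos.trans hs1)
      have : s ≤ 2 * B / lam := by rw [le_div_iff₀ hlam]; linarith
      linarith

end ConvexFunctions

/-! ### Fenchel–Rockafellar duality -/

section Duality

variable {H H₁ H₂ : Type*} [NormedAddCommGroup H] [InnerProductSpace ℝ H]
  [NormedAddCommGroup H₁] [InnerProductSpace ℝ H₁]
  [NormedAddCommGroup H₂] [InnerProductSpace ℝ H₂]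
  {φ : H → EReal} {g : H₁ → EReal} {f : H₂ → EReal} {L : H₁ →L[ℝ] H₂} {u : H₁} {b : H₂}

theorem IsProperConvexLsc.le_conjugate (hφ : IsProperConvexLsc φ) {x : H} (hx : φ x ≠ ⊤) (p : H) :
    ((inner ℝ p x - (φ x).toReal : ℝ) : EReal) ≤ conjugate φ p := by
  rw [EReal.coe_sub, hφ.coe_toReal hx]
  exact le_iSup (fun x : H => ((inner ℝ p x : ℝ) : EReal) - φ x) x

/-- Equality case of Fenchel–Young: the subgradient inequality says that `x` attains the supremum.
-/
theorem IsProperConvexLsc.conjugate_eq (hφ : IsProperConvexLsc φ) {x p : H}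
    (h : IsSubgradient φ x p) :
    conjugate φ p = ((inner ℝ p x - (φ x).toReal : ℝ) : EReal) := by
  refine le_antisymm (iSup_le fun y => ?_) (hφ.le_conjugate h.1 p)
  by_cases hy : φ y = ⊤
  · simp [hy]
  · rw [← hφ.coe_toReal hy, ← EReal.coe_sub, EReal.coe_le_coe_iff]
    have := h.2 y hy
    rw [inner_sub_right] at this
    linarith

/-- Continuity at `L x` keeps `L x - w` in the domain of `f` for small `w`, so the first alternative
implies the second. -/
theorem RegularityCondition.zero_mem_interior (h : RegularityCondition g f L) :
    (0 : H₂) ∈ interior {w : H₂ | ∃ x ∈ effDom g, ∃ y ∈ effDom f, w = L x - y} := by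
  obtain ⟨x, hxg, hxf, hc⟩ | h := h
  · rw [mem_interior_iff_mem_nhds]
    have h1 : Tendsto (fun w : H₂ => L x - w) (𝓝 0) (𝓝 (L x)) := by
      have : Continuous fun w : H₂ => L x - w := by fun_prop
      simpa using this.tendsto 0
    filter_upwards [h1.eventually (hc.eventually_lt_const (lt_top_iff_ne_top.2 hxf))] with w hw
    exact ⟨x, hxg, L x - w, hw.ne, by abel⟩
  · exact h

/-- Perturbations `w` admitting a feasible point of size at most `n`. -/
def perturbationSet (g : H₁ → EReal) (f : H₂ → EReal) (L : H₁ →L[ℝ] H₂) (n : ℕ) : Set H₂ :=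
  {w | ∃ x, ‖x‖ ≤ n ∧ g x ≤ (n : ℝ) ∧ f (L x - w) ≤ (n : ℝ)}

theorem monotone_perturbationSet : Monotone (perturbationSet g f L) := by
  rintro n m hnm w ⟨x, h1, h2, h3⟩
  have h : (n : ℝ) ≤ m := Nat.cast_le.2 hnm
  exact ⟨x, h1.trans h, h2.trans (EReal.coe_le_coe_iff.2 h), h3.trans (EReal.coe_le_coe_iff.2 h)⟩

theorem convex_perturbationSet (hg : IsProperConvexLsc g) (hf : IsProperConvexLsc f) (n : ℕ) :
    Convex ℝ (perturbationSet g f L n) := by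
  rintro w ⟨x, hx, hgx, hfx⟩ w' ⟨x', hx', hgx', hfx'⟩ s t hs ht hst
  refine ⟨s • x + t • x', ?_, hg.convex_sublevel n hgx hgx' hs ht hst, ?_⟩
  · simpa using convex_closedBall (0 : H₁) (n : ℝ) (by simpa using hx) (by simpa using hx') hs ht hst
  · have h1 : L (s • x + t • x') - (s • w + t • w') = s • (L x - w) + t • (L x' - w') := by
      simp only [map_add, map_smul, smul_sub]; abel
    rw [h1]
    exact hf.convex_sublevel n hfx hfx' hs ht hst

variable [CompleteSpace H₁] [CompleteSpace H₂]

/-- The Kuhn–Tucker conditions coupling a primal point `u` and a dual point `b`. -/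
def IsKKT (g : H₁ → EReal) (f : H₂ → EReal) (L : H₁ →L[ℝ] H₂) (u : H₁) (b : H₂) : Prop :=
  IsSubgradient g u (-(ContinuousLinearMap.adjoint L b)) ∧ IsSubgradient f (L u) b

theorem inner_neg_adjoint (L : H₁ →L[ℝ] H₂) (b : H₂) (u : H₁) :
    inner ℝ (-(ContinuousLinearMap.adjoint L b)) u = -inner ℝ b (L u) := by
  rw [inner_neg_left, ContinuousLinearMap.adjoint_inner_left]

/-- Taking `y = L u` or `x = u` decouples the inequality. Separation and passage to weak limits both
yield only this joint form. -/
theorem IsKKT.of_joint (hu : g u ≠ ⊤) (hLu : f (L u) ≠ ⊤)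
    (h : ∀ x y, g x ≠ ⊤ → f y ≠ ⊤ → (g u).toReal + (f (L u)).toReal + inner ℝ b (y - L x)
      ≤ (g x).toReal + (f y).toReal) : IsKKT g f L u b := by
  refine ⟨⟨hu, fun x hx => ?_⟩, hLu, fun y hy => ?_⟩
  · have := h x (L u) hx hLu
    rw [inner_neg_adjoint, map_sub, ← inner_neg_right, neg_sub]
    linarith
  · have := h u y hu hy
    linarith

theorem IsKKT.isSolution_primal (hg : IsProperConvexLsc g) (hf : IsProperConvexLsc f)
    (h : IsKKT g f L u b) : IsSolution (primalObjective g f L) u := by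
  have hval : primalObjective g f L u = ((g u).toReal + (f (L u)).toReal : ℝ) := by
    rw [EReal.coe_add, hg.coe_toReal h.1.1, hf.coe_toReal h.2.1, primalObjective]
  refine ⟨hval ▸ EReal.coe_ne_top _, fun w _ => ?_⟩
  change primalObjective g f L u ≤ primalObjective g f L w
  by_cases hgw : g w = ⊤
  · rw [primalObjective.eq_1 g f L w, hgw, EReal.top_add_of_ne_bot (hf.ne_bot _)]
    exact le_top
  by_cases hfw : f (L w) = ⊤
  · rw [primalObjective.eq_1 g f L w, hfw, EReal.add_top_of_ne_bot (hg.ne_bot _)]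
    exact le_top
  rw [hval, primalObjective, ← hg.coe_toReal hgw, ← hf.coe_toReal hfw, ← EReal.coe_add,
    EReal.coe_le_coe_iff]
  have h1 := h.1.2 w hgw
  have h2 := h.2.2 (L w) hfw
  rw [inner_neg_adjoint, map_sub] at h1
  linarith

theorem IsKKT.isSolution_dual (hg : IsProperConvexLsc g) (hf : IsProperConvexLsc f)
    (h : IsKKT g f L u b) : IsSolution (dualObjective g f L) b := by
  have hval : dualObjective g f L b = (-((g u).toReal + (f (L u)).toReal) : ℝ) := by
    rw [dualObjective, hg.conjugate_eq h.1, hf.conjugate_eq h.2, ← EReal.coe_add,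
      inner_neg_adjoint]
    congr 1; ring
  refine ⟨hval ▸ EReal.coe_ne_top _, fun w _ => ?_⟩
  change dualObjective g f L b ≤ dualObjective g f L w
  rw [hval]
  refine le_trans (le_of_eq ?_)
    (add_le_add (hg.le_conjugate h.1.1 (-(ContinuousLinearMap.adjoint L w)))
      (hf.le_conjugate h.2.1 w))
  rw [← EReal.coe_add, inner_neg_adjoint]
  congr 1; ring

/-- The norm bound on the feasible points supplies a weak limit, which is again feasible because the
constraints are weakly closed. -/
theorem isClosed_perturbationSet (hg : IsProperConvexLsc g) (hf : IsProperConvexLsc f) (n : ℕ) :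
    IsClosed (perturbationSet g f L n) := by
  refine isClosed_iff_ultrafilter.2 fun w U hU hmem => ?_
  choose! x hx hgx hfx using fun w (hw : w ∈ perturbationSet g f L n) => hw
  have hmem' : ∀ᶠ z in (U : Filter H₂), z ∈ perturbationSet g f L n := hmem
  obtain ⟨a, ha⟩ := WeakLim.exists_of_bounded U (hmem'.mono hx)
  have hw : WeakLim (U : Filter H₂) (fun z => L (x z) - z) (L a - w) :=
    (ha.map L).sub (WeakLim.of_tendsto hU)
  exact ⟨a, ha.norm_le (hmem'.mono hx),
    ha.mem_of_eventually (C := {x | g x ≤ (n : ℝ)}) (hg.convex_sublevel n)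
      (hg.lsc.isClosed_preimage _) (hmem'.mono hgx),
    hw.mem_of_eventually (C := {y | f y ≤ (n : ℝ)}) (hf.convex_sublevel n)
      (hf.lsc.isClosed_preimage _) (hmem'.mono hfx)⟩

/-- Baire's theorem gives one set an interior point `w`; averaging with `-w`, which lies in another
of these nested convex sets, moves it to `0`. -/
theorem exists_zero_mem_interior_perturbationSet (hg : IsProperConvexLsc g)
    (hf : IsProperConvexLsc f) (hreg : RegularityCondition g f L) :
    ∃ n, (0 : H₂) ∈ interior (perturbationSet g f L n) := by
  obtain ⟨ε, hε, hball⟩ :=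
    Metric.mem_nhds_iff.1 (mem_interior_iff_mem_nhds.1 hreg.zero_mem_interior)
  have hcov : ∀ w ∈ Metric.ball (0 : H₂) ε, ∃ n, w ∈ perturbationSet g f L n := by
    intro w hw
    obtain ⟨x, hx, y, hy, rfl⟩ := hball hw
    obtain ⟨n, hn⟩ := exists_nat_ge (max ‖x‖ (max (g x).toReal (f y).toReal))
    obtain ⟨h1, h2⟩ := max_le_iff.1 hn
    obtain ⟨h2, h3⟩ := max_le_iff.1 h2
    refine ⟨n, x, h1, ?_, ?_⟩
    · rw [← hg.coe_toReal hx]; exact EReal.coe_le_coe_iff.2 h2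
    · rw [sub_sub_cancel, ← hf.coe_toReal hy]; exact EReal.coe_le_coe_iff.2 h3
  have hdense := dense_iUnion_interior_of_closed
    (f := fun n => perturbationSet g f L n ∪ (Metric.ball (0 : H₂) ε)ᶜ)
    (fun n => (isClosed_perturbationSet hg hf n).union Metric.isOpen_ball.isClosed_compl)
    (eq_univ_of_forall fun w => mem_iUnion.2 <| by
      by_cases hw : w ∈ Metric.ball (0 : H₂) ε
      · exact (hcov w hw).imp fun n hn => Or.inl hn
      · exact ⟨0, Or.inr hw⟩)
  obtain ⟨w, hwb, hw⟩ := hdense.exists_mem_open Metric.isOpen_ball ⟨0, Metric.mem_ball_self hε⟩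
  obtain ⟨n, hwn⟩ := mem_iUnion.1 hwb
  have hint : w ∈ interior (perturbationSet g f L n) := by
    refine mem_interior.2 ⟨interior (perturbationSet g f L n ∪ (Metric.ball (0 : H₂) ε)ᶜ) ∩
      Metric.ball 0 ε, ?_, isOpen_interior.inter Metric.isOpen_ball, hwn, hw⟩
    rintro z ⟨hz, hzb⟩
    exact (interior_subset hz).resolve_right fun h => h hzb
  obtain ⟨m, hm⟩ := hcov (-w) (by simpa using hw)
  refine ⟨max n m, ?_⟩
  have := (convex_perturbationSet hg hf (max n m)).combo_interior_self_mem_interior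
    (interior_mono (monotone_perturbationSet (le_max_left n m)) hint)
    (monotone_perturbationSet (le_max_right n m) hm) (a := 1 / 2) (b := 1 / 2)
    (by norm_num) (by norm_num) (by norm_num)
  simpa using this

/-- Fenchel–Rockafellar duality: under the regularity condition every primal solution has a
Lagrange multiplier. -/
theorem exists_isKKT (hg : IsProperConvexLsc g) (hf : IsProperConvexLsc f)
    (hreg : RegularityCondition g f L) (hu : IsSolution (primalObjective g f L) u) :
    ∃ b, IsKKT g f L u b := by
  have hgu : g u ≠ ⊤ := fun h => hu.1 <| by
    rw [primalObjective, h, EReal.top_add_of_ne_bot (hf.ne_bot _)]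
  have hfu : f (L u) ≠ ⊤ := fun h => hu.1 <| by
    rw [primalObjective, h, EReal.add_top_of_ne_bot (hg.ne_bot _)]
  set p := (g u).toReal + (f (L u)).toReal with hp
  have hmin : ∀ x (r q : ℝ), g x ≤ r → f (L x) ≤ q → p ≤ r + q := by
    intro x r q hr hq
    rw [← EReal.coe_le_coe_iff, hp, EReal.coe_add, EReal.coe_add, hg.coe_toReal hgu,
      hf.coe_toReal hfu]
    exact (hu.2 (mem_univ x) : primalObjective g f L u ≤ primalObjective g f L x).trans
      (add_le_add hr hq)
  -- Essentially the epigraph of the value function of the perturbed problem, to be separated from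
  -- `(0, p)`.
  let E : Set (H₂ × ℝ) := {e | ∃ x, ∃ r q : ℝ, g x ≤ r ∧ f (L x - e.1) ≤ q ∧ r + q ≤ e.2}
  have hE : Convex ℝ E := by
    rintro e ⟨x, r, q, hr, hq, he⟩ e' ⟨x', r', q', hr', hq', he'⟩ s t hs ht hst
    refine ⟨s • x + t • x', s * r + t * r', s * q + t * q', hg.combo_le hr hr' hs ht hst, ?_, ?_⟩
    · have h1 : L (s • x + t • x') - (s • e + t • e').1
          = s • (L x - e.1) + t • (L x' - e'.1) := by
        simp only [map_add, map_smul, smul_sub, Prod.fst_add, Prod.smul_fst]; abel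
      rw [h1]
      exact hf.combo_le hq hq' hs ht hst
    · simp only [Prod.snd_add, Prod.smul_snd, smul_eq_mul]
      nlinarith [mul_le_mul_of_nonneg_left he hs, mul_le_mul_of_nonneg_left he' ht]
  obtain ⟨n, hn⟩ := exists_zero_mem_interior_perturbationSet hg hf hreg
  have hint : ((0 : H₂), (n + n + 1 : ℝ)) ∈ interior E := by
    refine mem_interior.2 ⟨interior (perturbationSet g f L n) ×ˢ Ioi ((n : ℝ) + n), ?_,
      isOpen_interior.prod isOpen_Ioi, hn, by simp⟩
    rintro ⟨w, r⟩ ⟨hw, hr⟩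
    obtain ⟨x, -, hgx, hfx⟩ := interior_subset hw
    exact ⟨x, n, n, hgx, hfx, le_of_lt hr⟩
  have hpn : p ≤ n + n := by
    obtain ⟨x, -, hgx, hfx⟩ := interior_subset hn
    exact hmin x n n hgx (by simpa using hfx)
  have hnot : ((0 : H₂), p) ∉ interior E := by
    intro h
    have hc : Continuous fun t : ℝ => ((0 : H₂), p - t) := by fun_prop
    have h0 : ∀ᶠ t in 𝓝[>] (0 : ℝ), ((0 : H₂), p - t) ∈ interior E :=
      (hc.continuousAt.eventually_mem (isOpen_interior.mem_nhds (by simpa using h))).filter_mono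
        nhdsWithin_le_nhds
    obtain ⟨t, ht, htpos⟩ := (h0.and self_mem_nhdsWithin).exists
    obtain ⟨x, r, q, hr, hq, hrq⟩ := interior_subset ht
    have := hmin x r q hr (by simpa using hq)
    have htpos : 0 < t := htpos
    simp only at hrq
    linarith
  obtain ⟨l, hl⟩ := geometric_hahn_banach_open_point hE.interior isOpen_interior hnot
  have hle : ∀ e ∈ E, l e ≤ l (0, p) := by
    intro e he
    have hcl : e ∈ closure (interior E) := by
      rw [hE.closure_interior_eq_closure_of_nonempty_interior ⟨_, hint⟩]
      exact subset_closure he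
    exact closure_minimal (fun z hz => (hl z hz).le)
      (isClosed_le l.continuous continuous_const) hcl
  let m : H₂ →L[ℝ] ℝ := l.comp (ContinuousLinearMap.inl ℝ H₂ ℝ)
  set β : ℝ := l (0, 1) with hβ
  have hdec : ∀ w (r : ℝ), l (w, r) = m w + r * β := by
    intro w r
    have : (w, r) = (w, (0 : ℝ)) + r • ((0 : H₂), (1 : ℝ)) := by simp
    rw [this, map_add, map_smul]; rfl
  -- The interior point above `(0, p)` rules out a vertical hyperplane; the slope `β⁻¹ • m` is then
  -- the multiplier.
  have hβneg : β < 0 := by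
    have := hl _ hint
    rw [hdec, hdec, map_zero] at this
    by_contra hcon
    nlinarith
  refine ⟨β⁻¹ • (InnerProductSpace.toDual ℝ H₂).symm m, IsKKT.of_joint hgu hfu ?_⟩
  intro x y hx hy
  have h1 := hle (L x - y, (g x).toReal + (f y).toReal)
    ⟨x, _, _, (hg.coe_toReal hx).ge, by simpa using (hf.coe_toReal hy).ge, le_rfl⟩
  rw [hdec, hdec, map_zero] at h1
  rw [inner_smul_left, InnerProductSpace.toDual_symm_apply, ← neg_sub (L x) y, map_neg]
  have h2 : β * β⁻¹ = 1 := mul_inv_cancel₀ hβneg.ne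
  rw [← hp]
  refine (mul_le_mul_left_of_neg hβneg).1 ?_
  have h3 : β * (p + (starRingEnd ℝ) β⁻¹ * -m (L x - y)) = β * p - (β * β⁻¹) * m (L x - y) := by
    rw [conj_trivial]; ring
  rw [h3, h2]
  linarith

/-- If `L* L` is surjective, then `L` has a bounded left inverse. -/
theorem exists_leftInverse (hL : Function.Surjective ((ContinuousLinearMap.adjoint L).comp L)) :
    ∃ S : H₂ →L[ℝ] H₁, ∀ x, S (L x) = x := by
  set T := (ContinuousLinearMap.adjoint L).comp L with hT
  -- `T` is self-adjoint, so its kernel is orthogonal to its range, the whole space.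
  have hinj : Function.Injective T := by
    refine (injective_iff_map_eq_zero T).2 fun x hx => ?_
    obtain ⟨z, hz⟩ := hL x
    have h1 : inner ℝ x x = inner ℝ (T x) z := by
      nth_rewrite 2 [← hz]
      simp [hT, ContinuousLinearMap.adjoint_inner_left, ContinuousLinearMap.adjoint_inner_right]
    rw [hx, inner_zero_left] at h1
    exact inner_self_eq_zero.1 h1
  let e := ContinuousLinearEquiv.ofBijective T (LinearMap.ker_eq_bot.2 hinj)
    (LinearMap.range_eq_top.2 hL)
  refine ⟨(e.symm : H₁ →L[ℝ] H₁).comp (ContinuousLinearMap.adjoint L), fun x => ?_⟩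
  exact e.symm_apply_apply x

end Duality

/-! ### Fejér monotonicity and weak convergence -/

section Convergence

variable {H H₁ H₂ : Type*} [NormedAddCommGroup H] [InnerProductSpace ℝ H]
  [NormedAddCommGroup H₁] [InnerProductSpace ℝ H₁]
  [NormedAddCommGroup H₂] [InnerProductSpace ℝ H₂]

theorem norm_sq_add_norm_sq_le {β δ : H} (h : 0 ≤ inner ℝ β δ) :
    ‖β‖ ^ 2 + ‖δ‖ ^ 2 ≤ ‖β + δ‖ ^ 2 := by
  rw [norm_add_sq_real]; linarith

/-- Right side minus left side equals `2⟨β, δ⟩ - 2⟨β + ν - δ, ν⟩`. -/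
theorem norm_sq_douglasRachford_step {β δ ν : H} (h₁ : 0 ≤ inner ℝ β δ)
    (h₂ : inner ℝ (β + ν - δ) ν ≤ 0) : ‖β + ν‖ ^ 2 + ‖δ - ν‖ ^ 2 ≤ ‖β + δ‖ ^ 2 := by
  rw [inner_sub_left, inner_add_left, real_inner_self_eq_norm_sq] at h₂
  rw [norm_add_sq_real, norm_sub_sq_real, norm_add_sq_real]
  linarith

variable [CompleteSpace H₁] [CompleteSpace H₂]

/-- The sequences `B`, `D`, `U` satisfy the optimality conditions of the algorithm. -/
structure IsIteration (g : H₁ → EReal) (f : H₂ → EReal) (L : H₁ →L[ℝ] H₂) (lam : ℝ)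
    (B D : ℕ → H₂) (U : ℕ → H₁) : Prop where
  subgradient_f : ∀ k, IsSubgradient f (D k) (lam • B k)
  subgradient_g : ∀ k,
    IsSubgradient g (U k) (-(ContinuousLinearMap.adjoint L (lam • (B k + L (U k) - D k))))
  step : ∀ k, B (k + 1) + D (k + 1) = B k + L (U k)

variable {g : H₁ → EReal} {f : H₂ → EReal} {L : H₁ →L[ℝ] H₂} {lam : ℝ}
  {B D : ℕ → H₂} {U : ℕ → H₁}

theorem inner_nonneg_of_smul_left (hlam : 0 < lam) {x y z : H}
    (h : 0 ≤ inner ℝ (lam • x - lam • y) z) : 0 ≤ inner ℝ (x - y) z := by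
  rw [← smul_sub, real_inner_smul_left] at h
  exact nonneg_of_mul_nonneg_right h hlam

theorem IsKKT.inner_nonneg (hlam : 0 < lam) {u₁ u₂ : H₁} {b₁ b₂ : H₂}
    (h₁ : IsKKT g f L u₁ (lam • b₁)) (h₂ : IsKKT g f L u₂ (lam • b₂)) :
    0 ≤ inner ℝ (b₁ - b₂) (L u₁ - L u₂) :=
  inner_nonneg_of_smul_left hlam (h₁.2.monotone h₂.2)

namespace IsIteration

theorem inner_nonneg (h : IsIteration g f L lam B D U) (hlam : 0 < lam) {u : H₁} {b : H₂}
    (hk : IsKKT g f L u (lam • b)) (k : ℕ) : 0 ≤ inner ℝ (B k - b) (D k - L u) :=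
  inner_nonneg_of_smul_left hlam ((h.subgradient_f k).monotone hk.2)

/-- Fejér monotonicity of `B + D` with respect to the Kuhn–Tucker set. -/
theorem fejer (h : IsIteration g f L lam B D U) (hlam : 0 < lam) {u : H₁} {b : H₂}
    (hk : IsKKT g f L u (lam • b)) (k : ℕ) :
    ‖B (k + 1) + D (k + 1) - (b + L u)‖ ^ 2 + ‖D k - L (U k)‖ ^ 2
      ≤ ‖B k + D k - (b + L u)‖ ^ 2 := by
  have h2 := (h.subgradient_g k).monotone hk.1
  rw [← neg_add', ← sub_eq_add_neg, ← map_sub, inner_neg_adjoint, map_sub, ← inner_neg_left,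
    neg_sub] at h2
  have h3 := inner_nonneg_of_smul_left hlam h2
  have := norm_sq_douglasRachford_step (β := B k - b) (δ := D k - L u) (ν := L (U k) - L u)
    (h.inner_nonneg hlam hk k) (by
      rw [← neg_nonneg, ← inner_neg_left]
      convert h3 using 2
      abel)
  rw [h.step]
  convert this using 4 <;> abel_nf

theorem antitone (h : IsIteration g f L lam B D U) (hlam : 0 < lam) {u : H₁} {b : H₂}
    (hk : IsKKT g f L u (lam • b)) : Antitone fun k => ‖B k + D k - (b + L u)‖ ^ 2 :=
  antitone_nat_of_succ_le fun k => by
    have := h.fejer hlam hk k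
    have := sq_nonneg ‖D k - L (U k)‖
    linarith

theorem summable (h : IsIteration g f L lam B D U) (hlam : 0 < lam) {u : H₁} {b : H₂}
    (hk : IsKKT g f L u (lam • b)) : Summable fun k => ‖D k - L (U k)‖ ^ 2 := by
  refine summable_of_sum_range_le (c := ‖B 0 + D 0 - (b + L u)‖ ^ 2) (fun _ => sq_nonneg _)
    fun n => ?_
  have : ∀ n, ∑ k ∈ Finset.range n, ‖D k - L (U k)‖ ^ 2 + ‖B n + D n - (b + L u)‖ ^ 2
      ≤ ‖B 0 + D 0 - (b + L u)‖ ^ 2 := by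
    intro n
    induction n with
    | zero => simp
    | succ n ih =>
      rw [Finset.sum_range_succ]
      linarith [h.fejer hlam hk n]
  linarith [this n, sq_nonneg ‖B n + D n - (b + L u)‖]

theorem tendsto_zero (h : IsIteration g f L lam B D U) (hlam : 0 < lam) {u : H₁} {b : H₂}
    (hk : IsKKT g f L u (lam • b)) : Tendsto (fun k => D k - L (U k)) atTop (𝓝 0) := by
  have := (h.summable hlam hk).tendsto_atTop_zero
  rw [tendsto_zero_iff_norm_tendsto_zero]
  simpa using this.sqrt

/-- Fejér monotonicity bounds only `B + D`; monotonicity of the subgradients of `f` bounds the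
summands separately. -/
theorem exists_bound (h : IsIteration g f L lam B D U) (hlam : 0 < lam) {u : H₁} {b : H₂}
    (hk : IsKKT g f L u (lam • b)) : ∃ R, ∀ k, ‖B k‖ ≤ R ∧ ‖D k‖ ≤ R := by
  set r := ‖B 0 + D 0 - (b + L u)‖ with hr
  have key : ∀ k, ‖B k - b‖ ^ 2 + ‖D k - L u‖ ^ 2 ≤ r ^ 2 := fun k => by
    refine (norm_sq_add_norm_sq_le (h.inner_nonneg hlam hk k)).trans ?_
    have := h.antitone hlam hk (Nat.zero_le k)
    convert this using 3
    abel
  refine ⟨r + ‖b‖ + ‖L u‖, fun k => ⟨?_, ?_⟩⟩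
  · have h1 : ‖B k - b‖ ≤ r := by
      refine (sq_le_sq₀ (norm_nonneg _) (norm_nonneg _)).1 ?_
      linarith [key k, sq_nonneg ‖D k - L u‖]
    have h2 := norm_le_norm_add_norm_sub' (B k) b
    linarith [norm_nonneg (L u)]
  · have h1 : ‖D k - L u‖ ≤ r := by
      refine (sq_le_sq₀ (norm_nonneg _) (norm_nonneg _)).1 ?_
      linarith [key k, sq_nonneg ‖B k - b‖]
    have h2 := norm_le_norm_add_norm_sub' (D k) (L u)
    linarith [norm_nonneg b]

/-- Weak limits along subfilters satisfy the Kuhn–Tucker conditions. -/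
theorem isKKT_of_weakLim (h : IsIteration g f L lam B D U)
    (hg : IsProperConvexLsc g) (hf : IsProperConvexLsc f)
    {F : Filter ℕ} [NeBot F] {R : ℝ} (hR : ∀ k, ‖B k‖ ≤ R ∧ ‖D k‖ ≤ R)
    (h0 : Tendsto (fun k => D k - L (U k)) F (𝓝 0))
    {u : H₁} {b : H₂} (hB : WeakLim F B b) (hD : WeakLim F D (L u)) (hU : WeakLim F U u) :
    IsKKT g f L u (lam • b) := by
  -- Neither product need converge under weak convergence, but their difference involves only
  -- pairings with `D k - L (U k)`, which tends strongly to zero.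
  set c : ℕ → ℝ := fun k => inner ℝ (B k) (D k) - inner ℝ (B k + L (U k) - D k) (L (U k)) with hc
  have hp : WeakLim F (fun k => B k + L (U k) - D k) b := by
    have := hB.sub (WeakLim.of_tendsto h0)
    rw [sub_zero] at this
    convert this using 2
    abel
  have hclim : Tendsto c F (𝓝 0) := by
    have hz : Tendsto (fun k => ‖D k - L (U k)‖) F (𝓝 0) := by simpa using h0.norm
    have hbd : Tendsto (fun k => ‖D k - L (U k)‖ * (2 * R) + ‖D k - L (U k)‖ ^ 2) F (𝓝 0) := by
      simpa using (hz.mul_const (2 * R)).add (hz.pow 2)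
    refine squeeze_zero_norm (fun k => ?_) hbd
    have e1 : c k = inner ℝ (D k - L (U k)) (B k) + inner ℝ (D k - L (U k)) (D k)
        - ‖D k - L (U k)‖ ^ 2 := by
      rw [hc, ← real_inner_self_eq_norm_sq]
      simp only [inner_sub_left, inner_sub_right, inner_add_left]
      rw [real_inner_comm (B k) (D k), real_inner_comm (B k) (L (U k))]
      ring
    have i1 := abs_real_inner_le_norm (D k - L (U k)) (B k)
    have i2 := abs_real_inner_le_norm (D k - L (U k)) (D k)
    have j1 : ‖D k - L (U k)‖ * ‖B k‖ ≤ ‖D k - L (U k)‖ * R := by gcongr; exact (hR k).1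
    have j2 : ‖D k - L (U k)‖ * ‖D k‖ ≤ ‖D k - L (U k)‖ * R := by gcongr; exact (hR k).2
    rw [Real.norm_eq_abs, e1]
    refine (abs_sub _ _).trans ?_
    rw [abs_of_nonneg (sq_nonneg ‖D k - L (U k)‖)]
    linarith [abs_add_le (inner ℝ (D k - L (U k)) (B k)) (inner ℝ (D k - L (U k)) (D k))]
  -- Real minorants are used because `g u` and `f (L u)` are not yet known to be finite; an infinite
  -- value would allow arbitrarily large ones.
  have key : ∀ (α β : ℝ), α < g u → β < f (L u) → ∀ x y, g x ≠ ⊤ → f y ≠ ⊤ →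
      α + β + inner ℝ (lam • b) (y - L x) ≤ (g x).toReal + (f y).toReal := by
    intro α β hα hβ x y hx hy
    have hlim : Tendsto (fun k => α + β + (lam * inner ℝ (B k) y
        - lam * inner ℝ (B k + L (U k) - D k) (L x) - lam * c k)) F
        (𝓝 (α + β + (lam * inner ℝ b y - lam * inner ℝ b (L x) - lam * 0))) :=
      ((((hB y).const_mul lam).sub ((hp (L x)).const_mul lam)).sub
        (hclim.const_mul lam)).const_add _
    rw [inner_sub_right, inner_smul_left, inner_smul_left, conj_trivial]
    rw [mul_zero, sub_zero] at hlim
    refine le_of_tendsto hlim ?_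
    filter_upwards [hU.eventually_lt hg.lsc hg.convex_sublevel hα,
      hD.eventually_lt hf.lsc hf.convex_sublevel hβ] with k hk1 hk2
    have h1 := (h.subgradient_g k).2 x hx
    have h2 := (h.subgradient_f k).2 y hy
    rw [← hg.coe_toReal (h.subgradient_g k).1, EReal.coe_lt_coe_iff] at hk1
    rw [← hf.coe_toReal (h.subgradient_f k).1, EReal.coe_lt_coe_iff] at hk2
    rw [inner_neg_adjoint, real_inner_smul_left, map_sub, inner_sub_right] at h1
    rw [real_inner_smul_left, inner_sub_right] at h2
    rw [hc]
    linarith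
  obtain ⟨x₀, hx₀⟩ := hg.proper
  obtain ⟨y₀, hy₀⟩ := hf.proper
  obtain ⟨α₀, -, hα₀⟩ := EReal.lt_iff_exists_real_btwn.1 (bot_lt_iff_ne_bot.2 (hg.ne_bot u))
  obtain ⟨β₀, -, hβ₀⟩ := EReal.lt_iff_exists_real_btwn.1 (bot_lt_iff_ne_bot.2 (hf.ne_bot (L u)))
  have hgu : g u ≠ ⊤ := fun htop => by
    have := key ((g x₀).toReal + (f y₀).toReal - β₀ - inner ℝ (lam • b) (y₀ - L x₀) + 1) β₀
      (htop ▸ EReal.coe_lt_top _) hβ₀ x₀ y₀ hx₀ hy₀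
    linarith
  have hfu : f (L u) ≠ ⊤ := fun htop => by
    have := key α₀ ((g x₀).toReal + (f y₀).toReal - α₀ - inner ℝ (lam • b) (y₀ - L x₀) + 1)
      hα₀ (htop ▸ EReal.coe_lt_top _) x₀ y₀ hx₀ hy₀
    linarith
  refine IsKKT.of_joint hgu hfu fun x y hx hy => le_of_forall_pos_le_add fun ε hε => ?_
  have := key ((g u).toReal - ε / 2) ((f (L u)).toReal - ε / 2)
    (by nth_rewrite 2 [← hg.coe_toReal hgu]; exact EReal.coe_lt_coe_iff.2 (by linarith))
    (by nth_rewrite 2 [← hf.coe_toReal hfu]; exact EReal.coe_lt_coe_iff.2 (by linarith)) x y hx hy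
  linarith

/-- Opial's argument: two Kuhn–Tucker points that are weak limits of the same iteration agree. -/
theorem eq_of_weakLim (h : IsIteration g f L lam B D U) (hlam : 0 < lam)
    {F₁ F₂ : Filter ℕ} [NeBot F₁] [NeBot F₂] (hF₁ : F₁ ≤ atTop) (hF₂ : F₂ ≤ atTop)
    {u₁ u₂ : H₁} {b₁ b₂ : H₂} (hk₁ : IsKKT g f L u₁ (lam • b₁)) (hk₂ : IsKKT g f L u₂ (lam • b₂))
    (hB₁ : WeakLim F₁ B b₁) (hD₁ : WeakLim F₁ D (L u₁))
    (hB₂ : WeakLim F₂ B b₂) (hD₂ : WeakLim F₂ D (L u₂)) : b₁ = b₂ ∧ L u₁ = L u₂ := by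
  have hconv : ∀ {u : H₁} {b : H₂}, IsKKT g f L u (lam • b) →
      ∃ l, Tendsto (fun k => ‖B k + D k - (b + L u)‖ ^ 2) atTop (𝓝 l) := fun hk =>
    ⟨_, tendsto_atTop_ciInf (h.antitone hlam hk) ⟨0, by rintro _ ⟨k, rfl⟩; positivity⟩⟩
  obtain ⟨l₁, hl₁⟩ := hconv hk₁
  obtain ⟨l₂, hl₂⟩ := hconv hk₂
  set t₁ := b₁ + L u₁ with ht₁
  set t₂ := b₂ + L u₂ with ht₂
  -- The difference of the two squared distances is affine in `B k + D k`, so this pairing converges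
  -- along the full sequence.
  have hl : Tendsto (fun k => inner ℝ (B k + D k) (t₂ - t₁)) atTop
      (𝓝 ((l₁ - l₂ + (‖t₂‖ ^ 2 - ‖t₁‖ ^ 2)) / 2)) := by
    refine (((hl₁.sub hl₂).add_const _).div_const 2).congr fun k => ?_
    rw [norm_sub_sq_real, norm_sub_sq_real, inner_sub_right]
    ring
  have e₁ := tendsto_nhds_unique (hB₁.add hD₁ (t₂ - t₁)) (hl.mono_left hF₁)
  have e₂ := tendsto_nhds_unique (hB₂.add hD₂ (t₂ - t₁)) (hl.mono_left hF₂)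
  rw [← ht₁] at e₁
  rw [← ht₂] at e₂
  have ht : t₂ - t₁ = 0 := by
    rw [← inner_self_eq_zero (𝕜 := ℝ), inner_sub_left, e₁, e₂, sub_self]
  -- Monotonicity upgrades equality of the sums `b + L u` to equality of both summands.
  have hm := norm_sq_add_norm_sq_le (hk₁.inner_nonneg hlam hk₂)
  have hs : b₁ - b₂ + (L u₁ - L u₂) = 0 := by
    rw [← neg_eq_zero, ← ht, ht₁, ht₂]; abel
  rw [hs, norm_zero, zero_pow two_ne_zero] at hm
  have n1 := sq_nonneg ‖b₁ - b₂‖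
  have n2 := sq_nonneg ‖L u₁ - L u₂‖
  exact ⟨sub_eq_zero.1 (norm_eq_zero.1 (pow_eq_zero_iff two_ne_zero |>.1 (by linarith))),
    sub_eq_zero.1 (norm_eq_zero.1 (pow_eq_zero_iff two_ne_zero |>.1 (by linarith)))⟩

theorem exists_weakLim (h : IsIteration g f L lam B D U) (hlam : 0 < lam)
    (hg : IsProperConvexLsc g) (hf : IsProperConvexLsc f) {S : H₂ →L[ℝ] H₁}
    (hS : ∀ x, S (L x) = x) {u : H₁} {b : H₂} (hk : IsKKT g f L u (lam • b)) :
    ∃ uhat bhat, IsKKT g f L uhat (lam • bhat) ∧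
      WeakLim atTop B bhat ∧ WeakLim atTop D (L uhat) ∧ WeakLim atTop U uhat := by
  obtain ⟨R, hR⟩ := h.exists_bound hlam hk
  have h0 := h.tendsto_zero hlam hk
  have hUlim : ∀ {F : Filter ℕ} {d : H₂}, F ≤ atTop → WeakLim F D d → WeakLim F U (S d) := by
    intro F d hF hd
    have := (hd.sub (WeakLim.of_tendsto (h0.mono_left hF))).map S
    simpa only [sub_sub_cancel, hS, sub_zero] using this
  have hex : ∀ V : Ultrafilter ℕ, (V : Filter ℕ) ≤ atTop → ∃ u' b', IsKKT g f L u' (lam • b') ∧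
      WeakLim V B b' ∧ WeakLim V D (L u') := by
    intro V hV
    obtain ⟨b', hb'⟩ := WeakLim.exists_of_bounded V (Eventually.of_forall fun k => (hR k).1)
    obtain ⟨d', hd'⟩ := WeakLim.exists_of_bounded V (Eventually.of_forall fun k => (hR k).2)
    have hu' := hUlim hV hd'
    have hLu : WeakLim (V : Filter ℕ) D (L (S d')) := by
      have := (hu'.map L).add (WeakLim.of_tendsto (h0.mono_left hV))
      simpa only [add_sub_cancel, add_zero] using this
    exact ⟨S d', b', h.isKKT_of_weakLim hg hf hR (h0.mono_left hV) hb' hLu hu', hb', hLu⟩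
  have hyp : (hyperfilter ℕ : Filter ℕ) ≤ atTop := Nat.hyperfilter_le_atTop
  obtain ⟨uhat, bhat, hkkt, hBh, hDh⟩ := hex (hyperfilter ℕ) hyp
  have hall : ∀ V : Ultrafilter ℕ, (V : Filter ℕ) ≤ atTop →
      WeakLim V B bhat ∧ WeakLim V D (L uhat) := by
    intro V hV
    obtain ⟨u', b', hk', hB', hD'⟩ := hex V hV
    obtain ⟨rfl, he⟩ := h.eq_of_weakLim hlam hyp hV hkkt hk' hBh hDh hB' hD'
    exact ⟨hB', he ▸ hD'⟩
  have hDlim : WeakLim atTop D (L uhat) := fun y =>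
    (tendsto_iff_ultrafilter _ _ _).2 fun V hV => (hall V hV).2 y
  refine ⟨uhat, bhat, hkkt, fun y =>
    (tendsto_iff_ultrafilter _ _ _).2 fun V hV => (hall V hV).1 y, hDlim, ?_⟩
  simpa only [hS] using hUlim le_rfl hDlim

end IsIteration

end Convergence

/-! ### From the algorithm to the abstract iteration -/

section Algorithm

variable {H₁ H₂ : Type*} [NormedAddCommGroup H₁] [InnerProductSpace ℝ H₁]
  [NormedAddCommGroup H₂] [InnerProductSpace ℝ H₂]
  {g : H₁ → EReal} {f : H₂ → EReal} {L : H₁ →L[ℝ] H₂} {lam : ℝ}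

theorem uObjective_eq (b d : H₂) : uObjective g L lam b d =
    fun u => g u + ((lam / 2 * ‖(b - d) + L u‖ ^ 2 : ℝ) : EReal) := by
  funext u
  rw [uObjective, sub_add_eq_add_sub]

theorem dObjective_eq (b : H₂) (u : H₁) : dObjective f L lam b u =
    fun d => f d + ((lam / 2 * ‖(b + L u) + (-ContinuousLinearMap.id ℝ H₂) d‖ ^ 2 : ℝ) : EReal) := by
  funext d
  rw [dObjective, neg_apply, ContinuousLinearMap.id_apply, sub_eq_add_neg]

variable [CompleteSpace H₁] [CompleteSpace H₂]

/-- The Kuhn–Tucker pair supplies affine minorants of `g` and `f`, and the quadratic terms are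
coercive, so the past of the run is irrelevant. -/
theorem wellDefined_of_isKKT (hg : IsProperConvexLsc g) (hf : IsProperConvexLsc f)
    (hlam : 0 < lam) {S : H₂ →L[ℝ] H₁} (hS : ∀ x, S (L x) = x) {u : H₁} {b : H₂}
    (hk : IsKKT g f L u b) (b₀ d₀ : H₂) : WellDefined g f L lam b₀ d₀ := by
  intro n u b d _ _ _
  refine ⟨?_, fun v _ => ?_⟩
  · rw [uObjective_eq]
    exact hg.exists_isMinOn_add_sq hlam (M := ‖S‖)
      (fun x => by simpa only [hS] using S.le_opNorm (L x)) hk.1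
  · rw [dObjective_eq]
    exact hf.exists_isMinOn_add_sq hlam (M := 1) (fun x => by simp) hk.2

/-- Indices start at `1` because the arbitrary `b₀`, `d₀` need not satisfy the subgradient relation
for `f`. -/
theorem IsRun.isIteration (hg : IsProperConvexLsc g) (hf : IsProperConvexLsc f) {b₀ d₀ : H₂}
    {u : ℕ → H₁} {b d : ℕ → H₂} (h : IsRun g f L lam b₀ d₀ u b d) :
    IsIteration g f L lam (fun k => b (k + 1)) (fun k => d (k + 1)) (fun k => u (k + 2)) where
  subgradient_f k := by
    have h1 := (h.2.2 k).d_min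
    rw [dObjective_eq] at h1
    convert hf.isSubgradient_of_isMinOn h1 using 1
    rw [(h.2.2 k).b_eq, map_neg, ContinuousLinearMap.adjoint_id]
    simp [sub_eq_add_neg]
  subgradient_g k := by
    have h1 := (h.2.2 (k + 1)).u_min
    rw [uObjective_eq] at h1
    convert hg.isSubgradient_of_isMinOn h1 using 5
    abel
  step k := by
    rw [(h.2.2 (k + 1)).b_eq]
    abel

end Algorithm

end SplitBregman

theorem theorem1p2 {H₁ H₂ : Type*}
    [NormedAddCommGroup H₁] [InnerProductSpace ℝ H₁] [CompleteSpace H₁]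
    [NormedAddCommGroup H₂] [InnerProductSpace ℝ H₂] [CompleteSpace H₂]
    (g : H₁ → EReal) (f : H₂ → EReal) (L : H₁ →L[ℝ] H₂) (lam : ℝ) (hlam : 0 < lam)
    (hg : SplitBregman.IsProperConvexLsc g) (hf : SplitBregman.IsProperConvexLsc f)
    (hreg : SplitBregman.RegularityCondition g f L)
    (hP : ∃ u : H₁, SplitBregman.IsSolution (SplitBregman.primalObjective g f L) u)
    (hD : ∃ b : H₂, SplitBregman.IsSolution (SplitBregman.dualObjective g f L) b)
    (hL : Function.Surjective ((ContinuousLinearMap.adjoint L).comp L))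
    (b₀ d₀ : H₂) :
    SplitBregman.WellDefined g f L lam b₀ d₀ ∧
    ∀ (u : ℕ → H₁) (b d : ℕ → H₂), SplitBregman.IsRun g f L lam b₀ d₀ u b d →
      ∃ bhat dhat : H₂,
        SplitBregman.WeaklyTendsto b bhat ∧
        SplitBregman.WeaklyTendsto d dhat ∧
        SplitBregman.IsSolution (SplitBregman.dualObjective g f L) (lam • bhat) ∧
        Tendsto (fun k => d k - L (u (k + 1))) atTop (𝓝 0) ∧
        Summable (fun k => ‖d k - L (u (k + 1))‖ ^ 2) ∧
        ∃ uhat : H₁,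
          (L uhat = dhat ∧ ∀ v : H₁, L v = dhat → v = uhat) ∧
          SplitBregman.IsSolution (SplitBregman.primalObjective g f L) uhat ∧
          ∀ ubar : H₁, SplitBregman.IsWeakClusterPt u ubar → ubar = uhat := by
  obtain ⟨u₀, hu₀⟩ := hP
  obtain ⟨y₀, hk⟩ := SplitBregman.exists_isKKT hg hf hreg hu₀
  obtain ⟨S, hS⟩ := SplitBregman.exists_leftInverse hL
  refine ⟨SplitBregman.wellDefined_of_isKKT hg hf hlam hS hk b₀ d₀, fun u b d hrun => ?_⟩
  have hit := hrun.isIteration hg hf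
  -- The iteration tracks dual points divided by `lam`.
  rw [← smul_inv_smul₀ hlam.ne' y₀] at hk
  obtain ⟨uhat, bhat, hkkt, hb, hd, hu⟩ := hit.exists_weakLim hlam hg hf hS hk
  refine ⟨bhat, L uhat, SplitBregman.weaklyTendsto_of_weakLim (.of_shift 1 hb),
    SplitBregman.weaklyTendsto_of_weakLim (.of_shift 1 hd), hkkt.isSolution_dual hg hf,
    (tendsto_add_atTop_iff_nat 1).1 (hit.tendsto_zero hlam hk),
    (summable_nat_add_iff 1).1 (hit.summable hlam hk), uhat, ⟨rfl, fun v hv => ?_⟩,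
    hkkt.isSolution_primal hg hf, fun ubar hubar => ?_⟩
  · rw [← hS v, hv, hS]
  · exact hubar.eq_of_weakLim (.of_shift 2 hu)
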